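/- Let $(A,\mathscr A,\mu)$ be a complete non-atomic measure space with $0<\mu(A)<\infty$, and let $(\Omega,\mathscr F,\mathbb P)$ be a separable non-atomic probability space. For $\beta\in[0,1)$ and $\mathcal X\in L^\infty(\mathbb P)$ put $$\mathrm{VaR}_\beta(\mathcal X)=\inf\{x\in\mathbb R:\mathbb P(\mathcal X\le x)\ge 1-\beta\}.$$ An allocation is a family $(X_a)_{a\in A}$ in $L^\infty(\mathbb P)$; it is called measurable if $a\mapsto\mathbb E^{\mathbb P}(X_a\mathcal Y)$ is $\mathscr A$-measurable for every $\mathcal Y\in L^1(\mathbb P)$. For $\mathcal X\in L^\infty(\mathbb P)$, let $\mathbb A(\mathcal X)$ be the set of measurable allocations $(X_a)_{a\in A}$ such that, for every $\mathcal Y\in L^1(\mathbb P)$, the function $a\mapsto\mathbb E^{\mathbb P}(X_a\mathcal Y)$ is $\mu$-integrable and $\int_A\mathbb E^{\mathbb P}(X_a\mathcal Y)\,\mu(da)=\mathbb E^{\mathbb P}(\mathcal X\mathcal Y)$ (that is, $\mathcal X$ is the Gelfand integral $\int_A X_a\,\mu(da)$). Let $(\beta_a)_{a\in A}\in[0,1)^A$,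 let $\varrho_a=\mathrm{VaR}_{\beta_a}$ for each $a\in A$, and assume that $a\mapsto\varrho_a(X_a)$ is $\mathscr A$-measurable for every measurable allocation $(X_a)_{a\in A}$. If $$\inf_{a\in A}\beta_a>0,$$ then the integral infimal convolution of $(\varrho_a)_{a\in A}$ is identically $-\infty$: for every $\mathcal X\in L^\infty(\mathbb P)$, $$\Big(\mathop{\Box}_{a\in A}\varrho_a\,\mu(da)\Big)(\mathcal X):=\inf_{(X_a)_{a\in A}\in\mathbb A(\mathcal X)}\int_A\varrho_a(X_a)\,\mu(da)=-\infty,$$ where $\int_A\varrho_a(X_a)\,\mu(da)\in[-\infty,\infty]$ is the integral of the positive part minus that of the negative part, and is set to $+\infty$ whenever the integral of the positive part is infinite. -/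

import Mathlib

open MeasureTheory
open scoped ENNReal

noncomputable section

namespace RiskSharing

/-- A (finite) measure is non-atomic if it has no atoms: every measurable set of positive measure
has a measurable subset of strictly smaller positive measure.  (Mathlib's `NoAtoms` only says
that singletons are null.) -/
def NonAtomic {T : Type*} [MeasurableSpace T] (ν : Measure T) : Prop :=
  ∀ s : Set T, MeasurableSet s → 0 < ν s →
    ∃ t ⊆ s, MeasurableSet t ∧ 0 < ν t ∧ ν t < ν s

variable {A Ω : Type*} [MeasurableSpace A] [MeasurableSpace Ω]

/-- The pairing `𝔼(𝒳𝒴)` of `𝒳 ∈ L^∞(ℙ)` with `𝒴 ∈ L¹(ℙ)`. -/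
def pairing (P : Measure Ω) (X : Lp ℝ ∞ P) (Y : Lp ℝ 1 P) : ℝ :=
  ∫ ω, X ω * Y ω ∂P

/-- An allocation `(X_a)_{a ∈ A}` in `L^∞(ℙ)` is measurable if `a ↦ 𝔼(X_a 𝒴)` is measurable for
each `𝒴 ∈ L¹(ℙ)`. -/
def MeasurableAllocation (P : Measure Ω) (X : A → Lp ℝ ∞ P) : Prop :=
  ∀ Y : Lp ℝ 1 P, Measurable fun a => pairing P (X a) Y

/-- A measurable allocation is Gelfand integrable if `a ↦ 𝔼(X_a 𝒴)` is `μ`-integrable for each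
`𝒴 ∈ L¹(ℙ)`. -/
def GelfandIntegrable (μ : Measure A) (P : Measure Ω) (X : A → Lp ℝ ∞ P) : Prop :=
  MeasurableAllocation P X ∧ ∀ Y : Lp ℝ 1 P, Integrable (fun a => pairing P (X a) Y) μ

/-- `Z` is the Gelfand integral of the Gelfand integrable allocation `X` over `B`. -/
def IsGelfandIntegral (μ : Measure A) (P : Measure Ω) (X : A → Lp ℝ ∞ P) (B : Set A)
    (Z : Lp ℝ ∞ P) : Prop :=
  GelfandIntegrable μ P X ∧
    ∀ Y : Lp ℝ 1 P, pairing P Z Y = ∫ a in B, pairing P (X a) Y ∂μ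

/-- The set `𝔸(𝒳)` of `𝒳`-feasible allocations. -/
def feasibleAllocations (μ : Measure A) (P : Measure Ω) (X : Lp ℝ ∞ P) :
    Set (A → Lp ℝ ∞ P) :=
  {Xa | IsGelfandIntegral μ P Xa Set.univ X}

/-- A family of functionals `ϱ_a : L^∞(ℙ) → ℝ` is measurable if `a ↦ ϱ_a(X_a)` is measurable for
each measurable allocation. -/
def MeasurableFamily (P : Measure Ω) (ϱ : A → Lp ℝ ∞ P → ℝ) : Prop :=
  ∀ X : A → Lp ℝ ∞ P, MeasurableAllocation P X → Measurable fun a => ϱ a (X a)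

open Classical in
/-- The extended-real integral `∫ f dμ = ∫ f⁺ dμ - ∫ f⁻ dμ` of a measurable `f`, with the
convention that it is `+∞` whenever `∫ f⁺ dμ = ∞`. -/
def extIntegral (μ : Measure A) (f : A → ℝ) : EReal :=
  if ∫⁻ a, ENNReal.ofReal (f a) ∂μ = ∞ then ⊤
  else ((∫⁻ a, ENNReal.ofReal (f a) ∂μ : ℝ≥0∞) : EReal)
    - ((∫⁻ a, ENNReal.ofReal (-f a) ∂μ : ℝ≥0∞) : EReal)

/-- The integral infimal convolution of the family `ϱ`, as a functional
`L^∞(ℙ) → [-∞, ∞]`. -/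
def integralInfConv (μ : Measure A) (P : Measure Ω) (ϱ : A → Lp ℝ ∞ P → ℝ)
    (X : Lp ℝ ∞ P) : EReal :=
  ⨅ Xa ∈ feasibleAllocations μ P X, extIntegral μ fun a => ϱ a (Xa a)

/-- Value at risk at level `β`.  For `β ∈ [0, 1)` and `ℙ` a probability measure the set is nonempty
and bounded below, so that the infimum is the genuine one. -/
def VaR (P : Measure Ω) (β : ℝ) (X : Lp ℝ ∞ P) : ℝ :=
  sInf {x : ℝ | 1 - β ≤ P.real {ω | X ω ≤ x}}

end RiskSharing

end

open MeasureTheory Filter Topology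
open scoped ENNReal

namespace RiskSharing

/-! ### Splitting a non-atomic space -/

section NonAtomic

variable {T : Type*} [MeasurableSpace T] {ν : Measure T}

/-! Write `ε = inf β > 0` and `m = μ(A)`. Cut `Ω` into finitely many events `B_j` of probability at
most `ε` (`exists_measurable_fin_small`) and `A` into equally many sets `A_j` of positive measure
(`exists_measurable_fin_pos`). Agents in `A_j` hold `X/m - M + (M m / μ(A_j)) 1_{B_j}`. As the `B_j`
partition `Ω`, the last terms integrate to `M m` and cancel the `-M`, so the allocation is feasible.
As `ℙ(B_j) ≤ β_a`, value at risk ignores the loss on `B_j` and is at most `‖X‖/m - M`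
(`exists_feasible_VaR_le`). Let `M → ∞`. -/

/-- A set of positive measure contains subsets of arbitrarily small positive measure. -/
theorem NonAtomic.exists_subset_measure_mul_two_pow_le (hν : NonAtomic ν) [IsFiniteMeasure ν]
    {s : Set T} (hs : MeasurableSet s) (hs0 : 0 < ν s) (n : ℕ) :
    ∃ t ⊆ s, MeasurableSet t ∧ 0 < ν t ∧ ν.real t * 2 ^ n ≤ ν.real s := by
  induction n with
  | zero => exact ⟨s, subset_rfl, hs, hs0, by simp⟩
  | succ n ih =>
    obtain ⟨t, hts, ht, ht0, hle⟩ := ih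
    obtain ⟨u, hut, hu, hu0, hlt⟩ := hν t ht ht0
    have hdiff : 0 < ν (t \ u) := by
      rw [measure_sdiff hut hu.nullMeasurableSet (measure_ne_top ν u)]
      exact tsub_pos_of_lt hlt
    have hsum : ν.real (t \ u) = ν.real t - ν.real u := measureReal_sdiff hut hu
    have hpow : (0 : ℝ) < 2 ^ n := by positivity
    -- The smaller of `u` and `t \ u` has at most half the measure of `t`.
    rcases le_total (ν.real u) (ν.real (t \ u)) with h | h
    · refine ⟨u, hut.trans hts, hu, hu0, ?_⟩
      rw [pow_succ]
      nlinarith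
    · refine ⟨t \ u, Set.sdiff_subset.trans hts, ht.diff hu, hdiff, ?_⟩
      rw [pow_succ]
      nlinarith

theorem NonAtomic.exists_subset_measureReal_le (hν : NonAtomic ν) [IsFiniteMeasure ν]
    {s : Set T} (hs : MeasurableSet s) (hs0 : 0 < ν s) {ε : ℝ} (hε : 0 < ε) :
    ∃ t ⊆ s, MeasurableSet t ∧ 0 < ν t ∧ ν.real t ≤ ε := by
  obtain ⟨n, hn⟩ := pow_unbounded_of_one_lt (ν.real s / ε) (one_lt_two)
  obtain ⟨t, hts, ht, ht0, hle⟩ := hν.exists_subset_measure_mul_two_pow_le hs hs0 n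
  refine ⟨t, hts, ht, ht0, ?_⟩
  rw [div_lt_iff₀ hε] at hn
  have hpow : (0 : ℝ) < 2 ^ n := by positivity
  nlinarith

/-- The space splits into any finite number of measurable pieces of positive measure. -/
theorem NonAtomic.exists_measurable_fin_pos (hν : NonAtomic ν) (h0 : 0 < ν Set.univ)
    (n : ℕ) [IsFiniteMeasure ν] :
    ∃ f : T → Fin (n + 1), Measurable f ∧ ∀ j, 0 < ν (f ⁻¹' {j}) := by
  classical
  induction n with
  | zero =>
    refine ⟨fun _ => 0, measurable_const, fun j => ?_⟩
    rwa [Fin.fin_one_eq_zero j, Set.preimage_const_of_mem (Set.mem_singleton _)]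
  | succ n ih =>
    obtain ⟨f, hf, hpos⟩ := ih
    obtain ⟨t, hts, ht, ht0, hlt⟩ :=
      hν _ (hf (measurableSet_singleton (Fin.last n))) (hpos _)
    -- Only the last cell is cut: `t` takes the new label, and the remainder stays non-null because
    -- `ν t` is strictly smaller.
    refine ⟨fun x => if x ∈ t then Fin.last (n + 1) else (f x).castSucc,
      Measurable.ite ht measurable_const ((measurable_of_finite _).comp hf), fun j => ?_⟩
    induction j using Fin.lastCases with
    | last =>
      refine ht0.trans_le (measure_mono fun x hx => ?_)
      simp [hx]
    | cast j =>
      have hle : 0 < ν (f ⁻¹' {j} \ t) := by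
        by_cases hj : j = Fin.last n
        · subst hj
          rw [measure_sdiff hts ht.nullMeasurableSet (measure_ne_top ν t)]
          exact tsub_pos_of_lt hlt
        · rw [sdiff_eq_left.2]
          · exact hpos j
          · refine Set.disjoint_left.2 fun x hx hxt => hj ?_
            have := hts hxt
            simp_all
      refine hle.trans_le (measure_mono fun x hx => ?_)
      simp_all

/-- The space is covered by finitely many measurable pieces of small measure. -/
theorem NonAtomic.exists_finite_cover (hν : NonAtomic ν) [IsFiniteMeasure ν]
    {ε : ℝ} (hε : 0 < ε) :
    ∃ F : Set (Set T), F.Finite ∧ (∀ s ∈ F, MeasurableSet s ∧ ν.real s ≤ ε) ∧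
      ⋃₀ F = Set.univ := by
  -- Exhaustion: `G` consists of the finite unions of small sets, and `S k` nearly attains the
  -- supremum of their measures.
  let G : Set (Set T) :=
    {S | ∃ F : Set (Set T), F.Finite ∧ (∀ s ∈ F, MeasurableSet s ∧ ν.real s ≤ ε) ∧ ⋃₀ F = S}
  have hGm : ∀ S ∈ G, MeasurableSet S := by
    rintro _ ⟨F, hF, hs, rfl⟩
    exact MeasurableSet.sUnion hF.countable fun s h => (hs s h).1
  have hG0 : ∅ ∈ G := ⟨∅, by simp⟩
  have hGu : ∀ S ∈ G, ∀ S' ∈ G, S ∪ S' ∈ G := by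
    rintro _ ⟨F, hF, hs, rfl⟩ _ ⟨F', hF', hs', rfl⟩
    exact ⟨F ∪ F', hF.union hF', fun s h => h.elim (hs s) (hs' s), Set.sUnion_union F F'⟩
  have hGs : ∀ t, MeasurableSet t → ν.real t ≤ ε → t ∈ G := fun t ht hle =>
    ⟨{t}, Set.finite_singleton t, by simp [ht, hle], by simp⟩
  have hbdd : BddAbove (ν.real '' G) :=
    ⟨ν.real Set.univ, by rintro _ ⟨S, -, rfl⟩; exact measureReal_mono (Set.subset_univ S)⟩
  have hne : (ν.real '' G).Nonempty := ⟨_, ∅, hG0, rfl⟩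
  have hseq : ∀ k : ℕ, ∃ S ∈ G, sSup (ν.real '' G) - 1 / ((k : ℝ) + 1) < ν.real S := by
    intro k
    obtain ⟨_, ⟨S, hS, rfl⟩, hlt⟩ := exists_lt_of_lt_csSup hne
      (sub_lt_self (sSup (ν.real '' G)) (Nat.one_div_pos_of_nat (α := ℝ) (n := k)))
    exact ⟨S, hS, hlt⟩
  choose S hSG hSlt using hseq
  have hU : MeasurableSet (⋃ k, S k) := MeasurableSet.iUnion fun k => hGm _ (hSG k)
  -- Otherwise a small non-null `t` misses every `S k`, and `S k ∪ t` beats the supremum once `1 /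
  -- (k + 1) < ν t`.
  have hnull : ν (⋃ k, S k)ᶜ = 0 := by
    by_contra hpos
    obtain ⟨t, hts, ht, ht0, hle⟩ :=
      hν.exists_subset_measureReal_le hU.compl (pos_iff_ne_zero.2 hpos) hε
    have htr : 0 < ν.real t := ENNReal.toReal_pos ht0.ne' (measure_ne_top ν t)
    obtain ⟨k, hk⟩ := exists_nat_one_div_lt htr
    have hdisj : Disjoint (S k) t := Set.disjoint_left.2 fun x hx hxt =>
      hts hxt (Set.mem_iUnion.2 ⟨k, hx⟩)
    have h1 := le_csSup hbdd ⟨_, hGu _ (hSG k) _ (hGs t ht hle), rfl⟩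
    rw [measureReal_union hdisj ht] at h1
    have h2 := hSlt k
    linarith
  have hacc : ∀ k, Set.accumulate S k ∈ G := by
    intro k
    induction k with
    | zero => simpa [Set.accumulate_zero_nat] using hSG 0
    | succ k ih =>
      rw [Set.accumulate_succ]
      exact hGu _ ih _ (hSG (k + 1))
  have htend : Tendsto (fun k => ν (Set.accumulate S k)ᶜ) atTop (𝓝 0) := by
    have h := tendsto_measure_iInter_atTop (μ := ν) (s := fun k => (Set.accumulate S k)ᶜ)
      (fun k => (hGm _ (hacc k)).compl.nullMeasurableSet)
      (fun i j hij => Set.compl_subset_compl.2 (Set.monotone_accumulate hij))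
      ⟨0, measure_ne_top _ _⟩
    rwa [← Set.compl_iUnion, Set.iUnion_accumulate, hnull] at h
  obtain ⟨k, hk⟩ := (htend.eventually_le_const (ENNReal.ofReal_pos.2 hε)).exists
  -- The complement of a late partial union is itself small, so it serves as the final piece.
  have hmem := hGu _ (hacc k) _ (hGs _ (hGm _ (hacc k)).compl
    (ENNReal.toReal_le_of_le_ofReal hε.le hk))
  rwa [Set.union_compl_self] at hmem

/-- The space splits into finitely many measurable pieces of small measure. -/
theorem NonAtomic.exists_measurable_fin_small (hν : NonAtomic ν) [IsFiniteMeasure ν]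
    {ε : ℝ} (hε : 0 < ε) :
    ∃ (n : ℕ) (f : T → Fin (n + 1)), Measurable f ∧ ∀ j, ν.real (f ⁻¹' {j}) ≤ ε := by
  classical
  obtain ⟨F, hF, hs, hcov⟩ := hν.exists_finite_cover hε
  obtain ⟨n, g, -, rfl⟩ := hF.fin_param
  have hex : ∀ x, ∃ k, ∃ h : k < n, x ∈ g ⟨k, h⟩ := fun x => by
    have hx : x ∈ ⋃₀ Set.range g := hcov ▸ Set.mem_univ x
    obtain ⟨_, ⟨k, rfl⟩, hk⟩ := hx
    exact ⟨k, k.2, hk⟩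
  have hfind : Measurable fun x => Nat.find (hex x) := by
    refine measurable_find hex fun k => ?_
    by_cases h : k < n
    · simpa [h] using (hs _ ⟨⟨k, h⟩, rfl⟩).1
    · simp [h]
  -- Taking the first index makes the cover disjoint. The label `n` is never used; it keeps the
  -- index type nonempty when `n = 0`.
  refine ⟨n, fun x => Fin.ofNat (n + 1) (Nat.find (hex x)),
    (measurable_from_top (f := Fin.ofNat (n + 1))).comp hfind, fun j => ?_⟩
  have hval : ∀ x ∈ (fun x => Fin.ofNat (n + 1) (Nat.find (hex x))) ⁻¹' {j},
      ∃ h : (j : ℕ) < n, x ∈ g ⟨j, h⟩ := by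
    rintro x rfl
    obtain ⟨h, hx⟩ := Nat.find_spec (hex x)
    have hmod : (Fin.ofNat (n + 1) (Nat.find (hex x)) : ℕ) = Nat.find (hex x) :=
      Nat.mod_eq_of_lt (h.trans (Nat.lt_succ_self n))
    simp only [hmod]
    exact ⟨h, hx⟩
  by_cases h : (j : ℕ) < n
  · exact (measureReal_mono fun x hx => (hval x hx).2).trans (hs _ ⟨⟨j, h⟩, rfl⟩).2
  · rw [Set.eq_empty_of_forall_notMem fun x hx => h (hval x hx).1, measureReal_empty]
    exact hε.le

end NonAtomic

/-! ### Finitely valued allocations, bounds on value at risk and on the integral -/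

variable {A Ω : Type*} [MeasurableSpace A] [MeasurableSpace Ω] {P : Measure Ω}

theorem ae_norm_le_norm (X : Lp ℝ ∞ P) : ∀ᵐ ω ∂P, ‖X ω‖ ≤ ‖X‖ := by
  filter_upwards [ae_le_lpNorm_exponent_top (Lp.memLp X)] with ω hω
  rwa [Lp.norm_def, toReal_eLpNorm (Lp.aestronglyMeasurable X)]

theorem pairing_sum_smul {ι : Type*} (s : Finset ι) (c : ι → ℝ) (Z : ι → Lp ℝ ∞ P)
    (Y : Lp ℝ 1 P) :
    pairing P (∑ j ∈ s, c j • Z j) Y = ∑ j ∈ s, c j * pairing P (Z j) Y := by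
  have hint : ∀ Z : Lp ℝ ∞ P, Integrable (fun ω => Z ω * Y ω) P := fun Z =>
    (L1.integrable_coeFn Y).mul_of_top_right (Lp.memLp Z)
  classical
  induction s using Finset.induction_on with
  | empty =>
    refine integral_eq_zero_of_ae ?_
    filter_upwards [Lp.coeFn_zero ℝ ∞ P] with ω hω
    rw [Finset.sum_empty, hω, Pi.zero_apply, zero_mul]
  | insert i s hi ih =>
    rw [Finset.sum_insert hi, Finset.sum_insert hi, ← ih]
    unfold pairing
    rw [← integral_const_mul, ← integral_add ((hint _).const_mul _) (hint _)]
    refine integral_congr_ae ?_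
    filter_upwards [Lp.coeFn_add (c i • Z i) (∑ j ∈ s, c j • Z j), Lp.coeFn_smul (c i) (Z i)]
      with ω h1 h2
    rw [h1, Pi.add_apply, h2, Pi.smul_apply, smul_eq_mul]
    ring

/-- A finitely valued allocation is Gelfand integrable, with the weighted sum of its values as
integral. -/
theorem isGelfandIntegral_comp {ι : Type*} [Fintype ι] [MeasurableSpace ι]
    [MeasurableSingletonClass ι] (μ : Measure A) [IsFiniteMeasure μ] {f : A → ι}
    (hf : Measurable f) (Z : ι → Lp ℝ ∞ P) :
    IsGelfandIntegral μ P (fun a => Z (f a)) Set.univ (∑ j, μ.real (f ⁻¹' {j}) • Z j) := by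
  have hint : ∀ Y : Lp ℝ 1 P, Integrable (fun j => pairing P (Z j) Y) (μ.map f) := fun Y =>
    Integrable.of_finite
  refine ⟨⟨fun Y => (measurable_of_finite fun j => pairing P (Z j) Y).comp hf,
    fun Y => (hint Y).comp_measurable hf⟩, fun Y => ?_⟩
  rw [pairing_sum_smul, setIntegral_univ,
    ← integral_map (f := fun j => pairing P (Z j) Y) hf.aemeasurable
      (hint Y).aestronglyMeasurable, integral_fintype (hint Y)]
  refine Finset.sum_congr rfl fun j _ => ?_
  rw [map_measureReal_apply hf (measurableSet_singleton j), smul_eq_mul]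

/-- A real `sInf` bounds nothing unless the set is bounded below. Here `-‖X‖` is a lower bound:
sublevel sets beneath it are null, while `1 - β > 0`. -/
theorem VaR_le {β : ℝ} (hβ : β < 1) {X : Lp ℝ ∞ P} {x : ℝ}
    (hx : 1 - β ≤ P.real {ω | X ω ≤ x}) : VaR P β X ≤ x := by
  refine csInf_le ⟨-‖X‖, fun y hy => ?_⟩ hx
  by_contra hlt
  have h0 : P {ω | X ω ≤ y} = 0 := by
    refine measure_mono_null (fun ω hω => ?_) (ae_iff.1 (ae_norm_le_norm X))
    intro hn
    have := neg_le_of_abs_le (Real.norm_eq_abs _ ▸ hn)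
    exact hlt (this.trans hω)
  have hy' : 1 - β ≤ P.real {ω | X ω ≤ y} := hy
  rw [measureReal_def, h0, ENNReal.toReal_zero] at hy'
  linarith

theorem extIntegral_le_of_le (μ : Measure A) [IsFiniteMeasure μ] {f : A → ℝ} {c : ℝ} (hc : 0 ≤ c)
    (hf : ∀ a, f a ≤ -c) : extIntegral μ f ≤ ((-(c * μ.real Set.univ) : ℝ) : EReal) := by
  have hpos : ∫⁻ a, ENNReal.ofReal (f a) ∂μ = 0 := by
    have : ∀ a, ENNReal.ofReal (f a) = 0 := fun a =>
      ENNReal.ofReal_of_nonpos ((hf a).trans (neg_nonpos.2 hc))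
    simp [this]
  have hneg : ENNReal.ofReal (c * μ.real Set.univ) ≤ ∫⁻ a, ENNReal.ofReal (-f a) ∂μ := by
    calc ENNReal.ofReal (c * μ.real Set.univ) = ∫⁻ _, ENNReal.ofReal c ∂μ := by
          rw [lintegral_const, ENNReal.ofReal_mul hc, ofReal_measureReal]
      _ ≤ _ := lintegral_mono fun a => ENNReal.ofReal_le_ofReal (le_neg_of_le_neg (hf a))
  rw [extIntegral, if_neg (by simp [hpos]), hpos, EReal.coe_ennreal_zero, zero_sub, EReal.coe_neg,
    EReal.neg_le_neg_iff]
  refine le_trans (le_of_eq ?_) (EReal.coe_ennreal_le_coe_ennreal_iff.2 hneg)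
  rw [EReal.coe_ennreal_ofReal, max_eq_left (by positivity)]

/-! ### The feasible allocation -/

theorem sum_indicatorConstLp_fiber [IsFiniteMeasure P] {ι : Type*} [Fintype ι]
    [MeasurableSpace ι] [MeasurableSingletonClass ι] {b : Ω → ι} (hb : Measurable b) (p : ℝ≥0∞) :
    ∑ j, indicatorConstLp p (hb (measurableSet_singleton j)) (measure_ne_top P _) (1 : ℝ) =
      Lp.const p P 1 := by
  classical
  refine Lp.ext ?_
  have h : ∀ j, indicatorConstLp p (hb (measurableSet_singleton j)) (measure_ne_top P _) (1 : ℝ)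
      =ᵐ[P] (b ⁻¹' {j}).indicator fun _ => (1 : ℝ) := fun j => indicatorConstLp_coeFn
  refine (Lp.coeFn_finsetSum _ _).trans ?_
  filter_upwards [ae_all_iff.2 h, Lp.coeFn_const (p := p) (μ := P) (1 : ℝ)] with ω hω h1
  rw [h1]
  simp [hω, Set.indicator_apply]

/-- The bound does not involve `d`: off `B` the indicator vanishes, and `Bᶜ` already has probability
at least `1 - β`. -/
theorem VaR_smul_sub_const_add_indicator_le [IsProbabilityMeasure P] {β : ℝ} (hβ : β < 1)
    {B : Set Ω} (hB : MeasurableSet B) (hle : P.real B ≤ β) (X : Lp ℝ ∞ P) {c : ℝ} (hc : 0 ≤ c)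
    (M d : ℝ) :
    VaR P β (c • X - M • Lp.const ∞ P 1 + d • indicatorConstLp ∞ hB (measure_ne_top P B) (1 : ℝ))
      ≤ c * ‖X‖ - M := by
  refine VaR_le hβ ?_
  set Z := c • X - M • Lp.const ∞ P 1 + d • indicatorConstLp ∞ hB (measure_ne_top P B) (1 : ℝ)
  have hae : ∀ᵐ ω ∂P, ω ∈ Bᶜ → Z ω ≤ c * ‖X‖ - M := by
    filter_upwards [Lp.coeFn_add (c • X - M • Lp.const ∞ P (1 : ℝ))
        (d • indicatorConstLp ∞ hB (measure_ne_top P B) (1 : ℝ)),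
      Lp.coeFn_sub (c • X) (M • Lp.const ∞ P (1 : ℝ)), Lp.coeFn_smul c X,
      Lp.coeFn_smul M (Lp.const ∞ P (1 : ℝ)), Lp.coeFn_const (p := ∞) (μ := P) (1 : ℝ),
      Lp.coeFn_smul d (indicatorConstLp ∞ hB (measure_ne_top P B) (1 : ℝ)),
      indicatorConstLp_coeFn_notMem (p := ∞) (hs := hB) (hμs := measure_ne_top P B) (c := (1 : ℝ)),
      ae_norm_le_norm X] with ω h1 h2 h3 h4 h5 h6 h7 h8 hω
    have hX := mul_le_mul_of_nonneg_left ((le_abs_self _).trans h8) hc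
    rw [h1, Pi.add_apply, h2, Pi.sub_apply, h3, h4, h6]
    simp only [Pi.smul_apply, smul_eq_mul, h7 hω, h5, Function.const_apply]
    linarith
  calc 1 - β ≤ P.real Bᶜ := by rw [probReal_compl_eq_one_sub hB]; linarith
    _ ≤ _ := ENNReal.toReal_mono (measure_ne_top P _) (measure_mono_ae hae)

/-- For every `M` there is a feasible allocation along which the value at risk is uniformly below
`‖X‖ / μ(A) - M`: each agent carries a huge loss on an event too unlikely to be seen. -/
theorem exists_feasible_VaR_le (μ : Measure A) [IsFiniteMeasure μ] (hμ0 : 0 < μ Set.univ)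
    (hμ : NonAtomic μ) [IsProbabilityMeasure P] (hP : NonAtomic P) {β : A → ℝ} {ε : ℝ}
    (hε : 0 < ε) (hεβ : ∀ a, ε ≤ β a) (hβ : ∀ a, β a < 1) (X : Lp ℝ ∞ P) (M : ℝ) :
    ∃ Xa ∈ feasibleAllocations μ P X,
      ∀ a, VaR P (β a) (Xa a) ≤ (μ.real Set.univ)⁻¹ * ‖X‖ - M := by
  obtain ⟨n, b, hb, hbε⟩ := hP.exists_measurable_fin_small hε
  obtain ⟨f, hf, hfpos⟩ := hμ.exists_measurable_fin_pos hμ0 n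
  set m := μ.real Set.univ with hm
  have hm0 : m ≠ 0 := (ENNReal.toReal_pos hμ0.ne' (measure_ne_top μ _)).ne'
  have hr : ∀ j, μ.real (f ⁻¹' {j}) ≠ 0 := fun j =>
    (ENNReal.toReal_pos (hfpos j).ne' (measure_ne_top μ _)).ne'
  have hsum : ∑ j, μ.real (f ⁻¹' {j}) = m := by
    rw [hm, sum_measureReal_preimage_singleton _ fun j _ => hf (measurableSet_singleton j)]
    simp
  -- Dividing by the measure of the `j`-th cell gives every indicator the same weight `M * m` after
  -- integration.
  let Z : Fin (n + 1) → Lp ℝ ∞ P := fun j =>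
    m⁻¹ • X - M • Lp.const ∞ P 1 + (M * m / μ.real (f ⁻¹' {j})) •
      indicatorConstLp ∞ (hb (measurableSet_singleton j)) (measure_ne_top P _) (1 : ℝ)
  have hZ : ∑ j, μ.real (f ⁻¹' {j}) • Z j = X := by
    have h1 : ∀ j, μ.real (f ⁻¹' {j}) • Z j =
        μ.real (f ⁻¹' {j}) • (m⁻¹ • X - M • Lp.const ∞ P 1) + (M * m) •
          indicatorConstLp ∞ (hb (measurableSet_singleton j)) (measure_ne_top P _) (1 : ℝ) := by
      intro j
      rw [smul_add, smul_smul _ (M * m / _), mul_div_cancel₀ _ (hr j)]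
    rw [Finset.sum_congr rfl fun j _ => h1 j, Finset.sum_add_distrib, ← Finset.sum_smul,
      ← Finset.smul_sum, sum_indicatorConstLp_fiber hb, hsum, smul_sub, smul_smul, smul_smul,
      mul_inv_cancel₀ hm0, one_smul, mul_comm m M, sub_add_cancel]
  refine ⟨fun a => Z (f a), ?_, fun a => ?_⟩
  · have h := isGelfandIntegral_comp μ hf Z
    rwa [hZ] at h
  · exact VaR_smul_sub_const_add_indicator_le (hβ a) _ ((hbε _).trans (hεβ a)) X
      (inv_nonneg.2 measureReal_nonneg) M _

end RiskSharing

theorem corollary4p4 {A Ω : Type*} [MeasurableSpace A] [MeasurableSpace Ω]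
    (μ : MeasureTheory.Measure A) [MeasureTheory.IsFiniteMeasure μ] [μ.IsComplete]
    (hμ_pos : 0 < μ Set.univ) (hμ : RiskSharing.NonAtomic μ)
    (P : MeasureTheory.Measure Ω) [MeasureTheory.IsProbabilityMeasure P]
    [MeasureTheory.IsSeparable P] (hP : RiskSharing.NonAtomic P)
    (β : A → ℝ) (hβ : ∀ a, β a ∈ Set.Ico (0 : ℝ) 1)
    (hmeas : RiskSharing.MeasurableFamily P fun a => RiskSharing.VaR P (β a))
    (hβ_inf : 0 < ⨅ a, β a) :
    ∀ X : MeasureTheory.Lp ℝ ⊤ P,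
      RiskSharing.integralInfConv μ P (fun a => RiskSharing.VaR P (β a)) X = ⊥ := by
  intro X
  have hbdd : BddBelow (Set.range β) := ⟨0, by rintro _ ⟨a, rfl⟩; exact (hβ a).1⟩
  set m := μ.real Set.univ with hm
  have hm0 : 0 < m := ENNReal.toReal_pos hμ_pos.ne' (measure_ne_top μ _)
  refine EReal.eq_bot_iff_forall_lt _ |>.2 fun y => ?_
  -- The chosen `M` makes each value at risk at most `-(|y| + 1) / m`, hence the integral at most
  -- `-(|y| + 1) < y`.
  have hc : 0 ≤ (|y| + 1) / m := by positivity
  obtain ⟨Xa, hXa, hle⟩ := RiskSharing.exists_feasible_VaR_le μ hμ_pos hμ hP hβ_inf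
    (fun a => ciInf_le hbdd a) (fun a => (hβ a).2) X (m⁻¹ * ‖X‖ + (|y| + 1) / m)
  refine (iInf₂_le Xa hXa).trans_lt ((RiskSharing.extIntegral_le_of_le μ hc fun a =>
    (hle a).trans (by linarith)).trans_lt ?_)
  rw [← hm, div_mul_cancel₀ _ hm0.ne', EReal.coe_lt_coe_iff]
  linarith [neg_abs_le y]
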